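/- Let $m,t$ be integers with $3<t<m+2$. Consider a network with terminal nodes $a,b$ and a set $\mathcal R$ of $m$ relays; put $\mathcal R^*=\mathcal R\cup\{a,b\}$. Node $i$ has a finite nonempty input alphabet $\mathcal X_i$ and a finite output alphabet $\mathcal Y_i$, each extended by a dummy symbol $\varnothing$ (no input, no output), and the channel $p(y_{\mathcal R^*}\mid x_{\mathcal R^*})$ is discrete, memoryless and half-duplex: a node with $x_i\neq\varnothing$ has $y_i=\varnothing$ with probability one. Node sets $R_0=\{a\}$, $R_1,\dots,R_{t-2}\subseteq\mathcal R$, $R_{t-1}=\{b\}$ are given. In the $(m,t)$ MHMR protocol every channel use belongs to one of $t$ phases, the assignment being fixed in advance; in phase $\ell\in\{1,\dots,t\}$ each node $i\in R_{t-\ell}$ transmits a symbol of $\mathcal X_i$, and every other node sends $\varnothing$. In a code of block length $n$ and rates $R_a,R_b\ge 0$, the nodes $a$ and $b$ have independent messages $W_a,W_b$, uniform on sets of sizes $\lfloor 2^{nR_a}\rfloor$ and $\lfloor 2^{nR_b}\rfloor$; relays have no messages. The symbol sent by a node is a function of its own message and of its past received symbols, $b$ estimates $W_a$ from $W_b$ and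 its $n$ received symbols, and $a$ estimates $W_b$ from $W_a$ and its $n$ received symbols. Fix $\Delta_1,\dots,\Delta_t\ge 0$ with $\sum_\ell\Delta_\ell=1$. The pair $(R_a,R_b)$ is achievable if there are such codes of block lengths $n=1,2,\dots$ for which both error probabilities tend to $0$ and the fraction of channel uses in phase $\ell$ tends to $\Delta_\ell$ for every $\ell$. The capacity region is the closure of the set of achievable pairs. Then for every $(R_a,R_b)$ in the capacity region there are input distributions $p^{(\ell)}$ of $(x_i)_{i\in R_{t-\ell}}\in\prod_{i\in R_{t-\ell}}\mathcal X_i$, $1\le\ell\le t$ (all other inputs being $\varnothing$), such that for every $S_R\subseteq\mathcal R$, with $\bar S_R=\mathcal R\setminus S_R$, $$R_a\le\sum_{i=0}^{t-1}\Delta_{t-i}\,I\big(X^{(t-i)}_{R_i\cap(S_R\cup\{a\})};\,Y^{(t-i)}_{\bar S_R\setminus R_i},Y^{(t-i)}_b\,\big|\,X^{(t-i)}_{\bar S_R\cap R_i}\big),$$ $$R_b\le\sum_{i=0}^{t-1}\Delta_{t-i}\,I\big(X^{(t-i)}_{R_i\cap(S_R\cup\{b\})};\,Y^{(t-i)}_{\bar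 S_R\setminus R_i},Y^{(t-i)}_a\,\big|\,X^{(t-i)}_{\bar S_R\cap R_i}\big).$$ Here $(X^{(\ell)},Y^{(\ell)})$ has law $p^{(\ell)}(x)\,p(y\mid x)$, $X_T$ and $Y_T$ denote the families of the inputs and outputs of the nodes in $T$, and mutual information is in bits. In other words, the capacity region is contained in the union, over all such families $(p^{(\ell)})_\ell$, of the sets of pairs that satisfy both bounds for all $S_R$. -/

import Mathlib

/-- The nodes of the network: the terminals `a` and `b` and the relays `r₁, …, rₘ`
(`relay i` for `i : Fin m`). -/
inductive MHMRNode (m : ℕ) : Type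
  | a : MHMRNode m
  | b : MHMRNode m
  | relay (i : Fin m) : MHMRNode m
  deriving DecidableEq, Fintype

namespace MHMR

noncomputable section

/-- The set of all relays. -/
def relays (m : ℕ) : Finset (MHMRNode m) :=
  Finset.univ.image MHMRNode.relay

/-! ### Entropy and mutual information on finite probability spaces, in bits -/

section Information

variable {Ω A B C : Type*} [Fintype Ω] [Fintype A] [Fintype B] [Fintype C]

open Classical in
/-- The probability that `f = v`, when the outcomes `ω` have the probabilities `P ω`. -/
def marginal (P : Ω → ℝ) (f : Ω → A) (v : A) : ℝ :=
  ∑ ω, if f ω = v then P ω else 0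

/-- Shannon entropy `H(f)` in bits. -/
def entropy (P : Ω → ℝ) (f : Ω → A) : ℝ :=
  ∑ v, Real.negMulLog (marginal P f v) / Real.log 2

/-- Conditional entropy `H(f | h) = H(f, h) - H(h)`. -/
def condEntropy (P : Ω → ℝ) (f : Ω → A) (h : Ω → C) : ℝ :=
  entropy P (fun ω => (f ω, h ω)) - entropy P h

/-- Conditional mutual information `I(f; g | h) = H(f | h) - H(f | g, h)`. -/
def condMutualInfo (P : Ω → ℝ) (f : Ω → A) (g : Ω → B) (h : Ω → C) : ℝ :=
  condEntropy P f h - condEntropy P f (fun ω => (g ω, h ω))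

end Information

/-! ### The channel

Node `i` has the input alphabet `X i` and the output alphabet `Y i`, both extended by the dummy
symbol `none` (no input, no output). -/

/-- Joint channel inputs of all nodes. -/
abbrev Input {m : ℕ} (X : MHMRNode m → Type*) := ∀ i, Option (X i)

/-- Joint channel outputs at all nodes. -/
abbrev Output {m : ℕ} (Y : MHMRNode m → Type*) := ∀ i, Option (Y i)

/-- A half-duplex discrete channel: `prob x y` is the probability of the joint output `y` given
the joint input `x`, and a node that transmits receives nothing. -/
structure Channel {m : ℕ} (X Y : MHMRNode m → Type*) [∀ i, Fintype (Y i)] where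
  prob : Input X → Output Y → ℝ
  prob_mem : ∀ x, prob x ∈ stdSimplex ℝ (Output Y)
  half_duplex : ∀ x y i, x i ≠ none → y i ≠ none → prob x y = 0

/-- `R 0 = {a}`, `R (t-1) = {b}`, and the sets `R 1, …, R (t-2)` of the intermediate hops consist
of relays. In phase `ℓ = 1, …, t` exactly the nodes in `R (t-ℓ)` transmit. -/
def IsRelayFamily {m t : ℕ} (R : Fin t → Finset (MHMRNode m)) : Prop :=
  ∀ i : Fin t,
    ((i : ℕ) = 0 → R i = {MHMRNode.a}) ∧
    ((i : ℕ) = t - 1 → R i = {MHMRNode.b}) ∧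
    (0 < (i : ℕ) → (i : ℕ) < t - 1 → R i ⊆ relays m)

/-! ### Codes

Phases are indexed by `Fin t` starting from `0`, so that phase `ℓ = 1, …, t` of the protocol is the
index `ℓ - 1`, and the nodes that transmit in the phase with index `ℓ` are those in `R ℓ.rev`. -/

/-- Sizes of the message sets: `⌊2 ^ (n Ra)⌋` at `a`, `⌊2 ^ (n Rb)⌋` at `b`; relays have no
message of their own, that is, a one-point message set. -/
def msgCount {m : ℕ} (n : ℕ) (Ra Rb : ℝ) : MHMRNode m → ℕ
  | .a => ⌊(2 : ℝ) ^ ((n : ℝ) * Ra)⌋₊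
  | .b => ⌊(2 : ℝ) ^ ((n : ℝ) * Rb)⌋₊
  | .relay _ => 1

/-- A code of block length `n` for the protocol with transmitting sets `R`, with message sets
`Fin (M i)`. Each channel use belongs to one of the `t` phases; the assignment is fixed in advance.
The symbol sent by node `i` at time `k` is a function of its message and of what it received
before time `k`; it is a symbol of `X i` if `i` transmits in the current phase, and `none` otherwise.
A decoder output `none` declares an error. -/
structure Code {m t : ℕ} (n : ℕ) (X Y : MHMRNode m → Type*)
    (R : Fin t → Finset (MHMRNode m)) (M : MHMRNode m → ℕ) where
  phase : Fin n → Fin t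
  encode : ∀ i, Fin (M i) → ∀ k : Fin n, (Fin (k : ℕ) → Option (Y i)) → Option (X i)
  encode_isSome : ∀ i w k y, (encode i w k y).isSome = true ↔ i ∈ R (phase k).rev
  decodeAtB : Fin (M .b) → (Fin n → Option (Y .b)) → Option (Fin (M .a))
  decodeAtA : Fin (M .a) → (Fin n → Option (Y .a)) → Option (Fin (M .b))

section Codes

variable {m t n : ℕ} {X Y : MHMRNode m → Type*} [∀ i, Fintype (Y i)]
  {R : Fin t → Finset (MHMRNode m)} {M : MHMRNode m → ℕ}

/-- The joint channel input at time `k`, for messages `w` and received sequences `y`. -/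
def Code.input (c : Code n X Y R M) (w : ∀ i, Fin (M i)) (y : Fin n → Output Y) (k : Fin n) :
    Input X :=
  fun i => c.encode i (w i) k (fun j => y (Fin.castLE k.isLt.le j) i)

/-- The probability that the messages are `w` and the received sequences are `y`: messages are
independent and uniform, and the channel is memoryless. -/
def Code.law (W : Channel X Y) (c : Code n X Y R M) (w : ∀ i, Fin (M i))
    (y : Fin n → Output Y) : ℝ :=
  (∏ i, (M i : ℝ))⁻¹ * ∏ k, W.prob (c.input w y k) (y k)

/-- The probability that `b` does not recover the message of `a`. -/
def Code.errorAtB (W : Channel X Y) (c : Code n X Y R M) : ℝ :=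
  ∑ w : ∀ i, Fin (M i), ∑ y : Fin n → Output Y,
    if c.decodeAtB (w .b) (fun k => y k .b) = some (w .a) then 0 else c.law W w y

/-- The probability that `a` does not recover the message of `b`. -/
def Code.errorAtA (W : Channel X Y) (c : Code n X Y R M) : ℝ :=
  ∑ w : ∀ i, Fin (M i), ∑ y : Fin n → Output Y,
    if c.decodeAtA (w .a) (fun k => y k .a) = some (w .b) then 0 else c.law W w y

/-- The fraction of the channel uses that belong to phase `ℓ`. -/
def Code.duration (c : Code n X Y R M) (ℓ : Fin t) : ℝ :=
  ((Finset.univ.filter fun k => c.phase k = ℓ).card : ℝ) / (n : ℝ)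

/-- The rate pair `(r.1, r.2) = (Ra, Rb)` is achievable with relative phase durations `Δ`. -/
def Achievable (W : Channel X Y) (R : Fin t → Finset (MHMRNode m)) (Δ : Fin t → ℝ)
    (r : ℝ × ℝ) : Prop :=
  0 ≤ r.1 ∧ 0 ≤ r.2 ∧
  ∃ c : ∀ n : ℕ, Code n X Y R (msgCount n r.1 r.2),
    Filter.Tendsto (fun n => (c n).errorAtB W) Filter.atTop (nhds 0) ∧
    Filter.Tendsto (fun n => (c n).errorAtA W) Filter.atTop (nhds 0) ∧
    ∀ ℓ, Filter.Tendsto (fun n => (c n).duration ℓ) Filter.atTop (nhds (Δ ℓ))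

/-- The capacity region for fixed phase durations `Δ`: the closure of the set of all achievable
rate pairs. -/
def capacityRegion (W : Channel X Y) (R : Fin t → Finset (MHMRNode m)) (Δ : Fin t → ℝ) :
    Set (ℝ × ℝ) :=
  closure {r | Achievable W R Δ r}

end Codes

/-! ### Single-letter quantities -/

section SingleLetter

variable {m : ℕ} {X Y : MHMRNode m → Type*} [∀ i, Fintype (X i)] [∀ i, Fintype (Y i)]

/-- `p` is a joint distribution of the inputs of the nodes in `T`, over the alphabets `X i`,
`i ∈ T`; all other inputs are `none`. -/
def IsInputLaw (T : Finset (MHMRNode m)) (p : Input X → ℝ) : Prop :=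
  p ∈ stdSimplex ℝ (Input X) ∧ ∀ x, p x ≠ 0 → ∀ i, (x i).isSome = true ↔ i ∈ T

/-- The joint distribution `p(x) p(y | x)` of channel input and output. -/
def jointLaw (W : Channel X Y) (p : Input X → ℝ) : Input X × Output Y → ℝ :=
  fun ω => p ω.1 * W.prob ω.1 ω.2

/-- `I(X_A; Y_B | X_C)` in bits, for the channel `W` with input distribution `p`. -/
def info (W : Channel X Y) (p : Input X → ℝ) (A B C : Finset (MHMRNode m)) : ℝ :=
  condMutualInfo (jointLaw W p)
    (fun ω => A.restrict ω.1) (fun ω => B.restrict ω.2) (fun ω => C.restrict ω.1)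

end SingleLetter

end

end MHMR

/-! This is a cut-set converse. For a sender `s` and a decoder `d`, let `D` consist of `d` and the
relays outside `S`. Fano's inequality and the chain rule bound the message entropy by a sum over
channel uses of differences of conditional entropies of the outputs at `D`. The current inputs at
`D` are determined by the messages other than that of `s` and by the past at `D`, and the channel is
memoryless, so each difference is at most `cutInfo`, the one-use quantity I(X; Y_D | X_D) at the law
of the actual input. This is `Code.logb_le_cutInfo`.

By concavity (`sum_cutInfo_le`), the input laws within a phase can be replaced by their average
(`Code.exists_phase_laws`). The average does not depend on the cut, so one family of laws serves
every `S` and both directions. Under the half-duplex constraint the remaining coordinates are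
constant on the support, which turns `cutInfo` into the stated information (`cutInfo_eq_info`).

These laws still depend on the block length. Input laws form a compact set on which information is
continuous, so a subsequential limit works (`CutSetBounds.exists_of_tendsto`); the same argument
handles the closure. -/

namespace MHMR

/-! ### Entropy inequalities: Gibbs, conditioning, concavity, Fano, continuity -/

section Information

variable {Ω A B C : Type*} [Fintype Ω]

theorem marginal_nonneg {P : Ω → ℝ} (hP : ∀ ω, 0 ≤ P ω) (f : Ω → A) (v : A) :
    0 ≤ marginal P f v := by
  classical
  unfold marginal
  exact Finset.sum_nonneg fun ω _ => by split_ifs <;> simp [hP]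

theorem marginal_pos {P : Ω → ℝ} (hP : ∀ ω, 0 ≤ P ω) (f : Ω → A) {ω : Ω} (h : P ω ≠ 0) :
    0 < marginal P f (f ω) := by
  classical
  unfold marginal
  refine Finset.sum_pos' (fun ω _ => by split_ifs <;> simp [hP]) ⟨ω, Finset.mem_univ _, ?_⟩
  simpa using lt_of_le_of_ne (hP ω) h.symm

theorem marginal_congr {P : Ω → ℝ} {f : Ω → A} {g : Ω → B} {a : A} {b : B}
    (h : ∀ ω, P ω ≠ 0 → (f ω = a ↔ g ω = b)) : marginal P f a = marginal P g b := by
  classical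
  unfold marginal
  refine Finset.sum_congr rfl fun ω _ => ?_
  by_cases h0 : P ω = 0
  · simp [h0]
  · simp [h ω h0]

theorem sum_marginal_pair [Fintype A] (P : Ω → ℝ) (f : Ω → A) (h : Ω → C) (c : C) :
    ∑ a, marginal P (fun ω => (f ω, h ω)) (a, c) = marginal P h c := by
  classical
  simp only [marginal]
  rw [Finset.sum_comm]
  refine Finset.sum_congr rfl fun ω _ => ?_
  rw [Finset.sum_eq_single (f ω)] <;> simp +contextual [eq_comm]

variable [Fintype A] [Fintype B] [Fintype C]

theorem sum_marginal_mul (P : Ω → ℝ) (f : Ω → A) (φ : A → ℝ) :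
    ∑ v, marginal P f v * φ v = ∑ ω, P ω * φ (f ω) := by
  classical
  simp only [marginal, Finset.sum_mul]
  rw [Finset.sum_comm]
  refine Finset.sum_congr rfl fun ω _ => ?_
  rw [Finset.sum_eq_single (f ω)] <;> simp +contextual [eq_comm]

theorem sum_marginal (P : Ω → ℝ) (f : Ω → A) : ∑ v, marginal P f v = ∑ ω, P ω := by
  simpa using sum_marginal_mul P f 1

/-- Summing over outcomes instead of values lets entropies of functions with different codomains be
compared term by term. -/
theorem entropy_eq_neg_sum (P : Ω → ℝ) (f : Ω → A) :
    entropy P f = -∑ ω, P ω * Real.logb 2 (marginal P f (f ω)) := by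
  rw [← sum_marginal_mul P f (fun v => Real.logb 2 (marginal P f v)), entropy,
    ← Finset.sum_neg_distrib]
  refine Finset.sum_congr rfl fun v _ => ?_
  simp only [Real.negMulLog, Real.logb]
  ring

/-- Entropy depends only on the partition that a function induces on the support. -/
theorem entropy_congr {P : Ω → ℝ} {f : Ω → A} {g : Ω → B}
    (h : ∀ ω ω', P ω ≠ 0 → P ω' ≠ 0 → (f ω = f ω' ↔ g ω = g ω')) :
    entropy P f = entropy P g := by
  rw [entropy_eq_neg_sum, entropy_eq_neg_sum]
  refine congrArg Neg.neg (Finset.sum_congr rfl fun ω _ => ?_)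
  by_cases h0 : P ω = 0
  · simp [h0]
  · rw [marginal_congr fun ω' h' => h ω' ω h' h0]

theorem condEntropy_congr {A' C' : Type*} [Fintype A'] [Fintype C'] {P : Ω → ℝ}
    {f : Ω → A} {h : Ω → C} {f' : Ω → A'} {h' : Ω → C'}
    (hh : ∀ ω ω', P ω ≠ 0 → P ω' ≠ 0 → (h ω = h ω' ↔ h' ω = h' ω'))
    (hf : ∀ ω ω', P ω ≠ 0 → P ω' ≠ 0 → h ω = h ω' → (f ω = f ω' ↔ f' ω = f' ω')) :
    condEntropy P f h = condEntropy P f' h' := by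
  unfold condEntropy
  congr 1
  · refine entropy_congr fun ω ω' h1 h2 => ?_
    simp only [Prod.mk.injEq]
    have := hh ω ω' h1 h2
    have := hf ω ω' h1 h2
    tauto
  · exact entropy_congr hh

/-- Used to move between the space of a whole code and the single-letter space of one channel use.
-/
theorem entropy_marginal (P : Ω → ℝ) (T : Ω → B) (f : B → A) :
    entropy (marginal P T) f = entropy P (fun ω => f (T ω)) := by
  classical
  have : ∀ v, marginal (marginal P T) f v = marginal P (fun ω => f (T ω)) v := by
    intro v
    have := sum_marginal_mul P T (fun b => if f b = v then 1 else 0)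
    simp only [mul_ite, mul_one, mul_zero] at this
    unfold marginal at this ⊢
    exact this
  simp only [entropy, this]

theorem condEntropy_marginal (P : Ω → ℝ) (T : Ω → B) (f : B → A) (h : B → C) :
    condEntropy (marginal P T) f h = condEntropy P (fun ω => f (T ω)) (fun ω => h (T ω)) := by
  simp only [condEntropy, entropy_marginal]

/-- Conditional entropy as an average of log-likelihoods. -/
theorem condEntropy_eq_neg_sum {P : Ω → ℝ} (hP : ∀ ω, 0 ≤ P ω) (f : Ω → A) (h : Ω → C)
    (K : Ω → ℝ)
    (hK : ∀ ω, P ω ≠ 0 →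
      marginal P (fun ω => (f ω, h ω)) (f ω, h ω) = marginal P h (h ω) * K ω) :
    condEntropy P f h = -∑ ω, P ω * Real.logb 2 (K ω) := by
  rw [condEntropy, entropy_eq_neg_sum, entropy_eq_neg_sum, neg_sub_neg,
    ← Finset.sum_sub_distrib, ← Finset.sum_neg_distrib]
  refine Finset.sum_congr rfl fun ω _ => ?_
  by_cases h0 : P ω = 0
  · simp [h0]
  have h1 := marginal_pos hP (fun ω => (f ω, h ω)) h0
  have h2 := marginal_pos hP h h0
  rw [hK ω h0] at h1 ⊢
  rw [Real.logb_mul h2.ne' (pos_of_mul_pos_right h1 h2.le).ne']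
  ring

/-- Gibbs' inequality for conditional entropy. -/
theorem condEntropy_le_neg_sum {P : Ω → ℝ} (hP : ∀ ω, 0 ≤ P ω) (f : Ω → A) (h : Ω → C)
    (Q : C → A → ℝ) (hQ : ∀ c a, 0 ≤ Q c a) (hQ1 : ∀ c, ∑ a, Q c a ≤ 1)
    (hQ0 : ∀ ω, P ω ≠ 0 → 0 < Q (h ω) (f ω)) :
    condEntropy P f h ≤ -∑ ω, P ω * Real.logb 2 (Q (h ω) (f ω)) := by
  set p : A × C → ℝ := marginal P (fun ω => (f ω, h ω)) with hp
  have hp0 : ∀ v, 0 ≤ p v := marginal_nonneg hP _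
  rw [condEntropy_eq_neg_sum hP f h (fun ω => p (f ω, h ω) / marginal P h (h ω))
    fun ω h0 => by rw [mul_div_cancel₀ _ (marginal_pos hP h h0).ne'], neg_le_neg_iff]
  have hl : (0 : ℝ) < Real.log 2 := Real.log_pos one_lt_two
  -- The likelihood ratio of `Q` to the true conditional law has mean at most the total mass; the
  -- claim then follows from log u ≤ u - 1.
  have key : ∑ ω, P ω * (Q (h ω) (f ω) * marginal P h (h ω) / p (f ω, h ω)) ≤ ∑ ω, P ω := by
    rw [← sum_marginal_mul P (fun ω => (f ω, h ω))
      (fun v => Q v.2 v.1 * marginal P h v.2 / p v)]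
    calc ∑ v, p v * (Q v.2 v.1 * marginal P h v.2 / p v)
        ≤ ∑ v : A × C, Q v.2 v.1 * marginal P h v.2 := by
          refine Finset.sum_le_sum fun v _ => ?_
          by_cases h0 : p v = 0
          · simpa [h0] using mul_nonneg (hQ _ _) (marginal_nonneg hP h _)
          · rw [mul_div_cancel₀ _ h0]
      _ = ∑ c, (∑ a, Q c a) * marginal P h c := by
          rw [Fintype.sum_prod_type_right]; simp [Finset.sum_mul]
      _ ≤ ∑ c, marginal P h c :=
          Finset.sum_le_sum fun c _ => mul_le_of_le_one_left (marginal_nonneg hP h c) (hQ1 c)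
      _ = _ := sum_marginal P h
  have : ∑ ω, P ω * Real.logb 2 (Q (h ω) (f ω)) -
      ∑ ω, P ω * Real.logb 2 (p (f ω, h ω) / marginal P h (h ω)) ≤
      ∑ ω, (P ω * (Q (h ω) (f ω) * marginal P h (h ω) / p (f ω, h ω)) - P ω) / Real.log 2 := by
    rw [← Finset.sum_sub_distrib]
    refine Finset.sum_le_sum fun ω _ => ?_
    by_cases h0 : P ω = 0
    · simp [h0]
    have h1 : 0 < p (f ω, h ω) := marginal_pos hP (fun ω => (f ω, h ω)) h0
    have h2 := marginal_pos hP h h0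
    have h3 := hQ0 ω h0
    rw [← mul_sub, ← Real.logb_div h3.ne' (div_pos h1 h2).ne', div_div_eq_mul_div, Real.logb,
      ← mul_div_assoc, div_le_div_iff_of_pos_right hl]
    have := mul_le_mul_of_nonneg_left (Real.log_le_sub_one_of_pos
      (div_pos (mul_pos h3 h2) h1)) (hP ω)
    linarith
  rw [← Finset.sum_div, Finset.sum_sub_distrib] at this
  have h4 := div_nonpos_of_nonpos_of_nonneg (sub_nonpos.2 key) hl.le
  linarith

omit [Fintype C] in
/-- The conditional probabilities of `f` given `h` form a sub-stochastic kernel that is positive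
on the support. -/
theorem condProb_facts {P : Ω → ℝ} (hP : ∀ ω, 0 ≤ P ω) (f : Ω → A) (h : Ω → C) :
    (∀ c a, 0 ≤ marginal P (fun ω => (f ω, h ω)) (a, c) / marginal P h c) ∧
    (∀ c, ∑ a, marginal P (fun ω => (f ω, h ω)) (a, c) / marginal P h c ≤ 1) ∧
    (∀ ω, P ω ≠ 0 →
      0 < marginal P (fun ω => (f ω, h ω)) (f ω, h ω) / marginal P h (h ω)) := by
  refine ⟨fun c a => div_nonneg (marginal_nonneg hP _ _) (marginal_nonneg hP _ _), fun c => ?_,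
    fun ω h0 => div_pos (marginal_pos hP (fun ω => (f ω, h ω)) h0) (marginal_pos hP h h0)⟩
  rw [← Finset.sum_div, sum_marginal_pair]
  -- The sum is 0 rather than 1 where `c` has probability zero, since division by zero gives 0.
  exact div_self_le_one _

/-- Conditioning reduces entropy. -/
theorem condEntropy_le_of_determines {C' : Type*} [Fintype C'] {P : Ω → ℝ} (hP : ∀ ω, 0 ≤ P ω)
    (f : Ω → A) {h : Ω → C} {h' : Ω → C'}
    (hh : ∀ ω ω', P ω ≠ 0 → P ω' ≠ 0 → h ω = h ω' → h' ω = h' ω') :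
    condEntropy P f h ≤ condEntropy P f h' := by
  have h1 : condEntropy P f h = condEntropy P f (fun ω => (h ω, h' ω)) := by
    refine condEntropy_congr (fun ω ω' h1 h2 => ?_) fun _ _ _ _ _ => Iff.rfl
    simp only [Prod.mk.injEq]
    exact ⟨fun h3 => ⟨h3, hh _ _ h1 h2 h3⟩, And.left⟩
  obtain ⟨q1, q2, q3⟩ := condProb_facts hP f h'
  rw [h1, condEntropy_eq_neg_sum hP f h' (fun ω => marginal P (fun ω => (f ω, h' ω)) (f ω, h' ω) /
    marginal P h' (h' ω)) fun ω h0 => by rw [mul_div_cancel₀ _ (marginal_pos hP h' h0).ne']]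
  -- Gibbs with a test kernel that ignores `h`: the true conditional law of `f` given `h'`.
  exact condEntropy_le_neg_sum hP f (fun ω => (h ω, h' ω))
    (fun c a => marginal P (fun ω => (f ω, h' ω)) (a, c.2) / marginal P h' c.2)
    (fun c a => q1 c.2 a) (fun c => q2 c.2) q3

/-- Conditional entropy is concave in the distribution. -/
theorem sum_condEntropy_le {ι : Type*} (s : Finset ι) (c : ι → ℝ) (hc : ∀ k ∈ s, 0 < c k)
    (P : ι → Ω → ℝ) (hP : ∀ k ω, 0 ≤ P k ω) (f : Ω → A) (h : Ω → C) :
    ∑ k ∈ s, c k * condEntropy (P k) f h ≤ condEntropy (fun ω => ∑ k ∈ s, c k * P k ω) f h := by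
  set Q : Ω → ℝ := fun ω => ∑ k ∈ s, c k * P k ω with hQ
  have hQ0 : ∀ ω, 0 ≤ Q ω := fun ω =>
    Finset.sum_nonneg fun k hk => mul_nonneg (hc k hk).le (hP k ω)
  obtain ⟨q1, q2, q3⟩ := condProb_facts hQ0 f h
  rw [condEntropy_eq_neg_sum hQ0 f h (fun ω => marginal Q (fun ω => (f ω, h ω)) (f ω, h ω) /
    marginal Q h (h ω)) fun ω h0 => by rw [mul_div_cancel₀ _ (marginal_pos hQ0 h h0).ne']]
  set K : Ω → ℝ := fun ω => Real.logb 2 (marginal Q (fun ω => (f ω, h ω)) (f ω, h ω) /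
    marginal Q h (h ω)) with hK
  have hsum : -∑ ω, Q ω * K ω = ∑ k ∈ s, c k * -∑ ω, P k ω * K ω := by
    simp only [hQ, mul_neg, Finset.sum_neg_distrib, Finset.sum_mul, Finset.mul_sum, mul_assoc]
    rw [Finset.sum_comm]
  rw [hsum]
  refine Finset.sum_le_sum fun k hk => mul_le_mul_of_nonneg_left ?_ (hc k hk).le
  -- Every component is tested against the conditional law of the mixture; the resulting bounds add
  -- up exactly to the entropy of the mixture.
  refine condEntropy_le_neg_sum (hP k) f h
    (fun c a => marginal Q (fun ω => (f ω, h ω)) (a, c) / marginal Q h c) q1 q2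
    fun ω h0 => q3 ω ?_
  have h1 : 0 < c k * P k ω := mul_pos (hc k hk) (lt_of_le_of_ne (hP k ω) (Ne.symm h0))
  exact (h1.trans_le (Finset.single_le_sum
    (f := fun k => c k * P k ω) (fun j hj => mul_nonneg (hc j hj).le (hP j ω)) hk)).ne'

open Classical in
/-- Fano's inequality. -/
theorem condEntropy_le_fano {P : Ω → ℝ} (hP : P ∈ stdSimplex ℝ Ω) (f : Ω → A) (h : Ω → C)
    (g : C → Option A) :
    condEntropy P f h ≤
      1 + (∑ ω, if g (h ω) = some (f ω) then 0 else P ω) * Real.logb 2 (Fintype.card A) := by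
  obtain ⟨hP, hP1⟩ := hP
  rcases isEmpty_or_nonempty A with hA | hA
  · have : IsEmpty Ω := Function.isEmpty f
    simp at hP1
  have hN : (1 : ℝ) ≤ Fintype.card A := by exact_mod_cast Fintype.card_pos (α := A)
  have hN0 : (0 : ℝ) < Fintype.card A := by linarith
  have hu : 0 < (2 * (Fintype.card A : ℝ))⁻¹ := by positivity
  -- Test kernel: mass 1/2 on the guess and mass 1/2 spread uniformly. A correct guess costs at most
  -- 1 bit, a wrong one 1 + log |A| bits.
  refine (condEntropy_le_neg_sum hP f h
    (fun c a => (if g c = some a then 2⁻¹ else 0) + (2 * (Fintype.card A : ℝ))⁻¹)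
    (fun c a => by split_ifs <;> positivity) (fun c => ?_)
    (fun ω _ => by split_ifs <;> positivity)).trans ?_
  · rw [Finset.sum_add_distrib]
    have h1 : ∑ a, (if g c = some a then (2⁻¹ : ℝ) else 0) ≤ 2⁻¹ := by
      cases hg : g c with
      | none => simp
      | some a => simp
    have h2 : ∑ _a : A, (2 * (Fintype.card A : ℝ))⁻¹ = 2⁻¹ := by
      simp
    rw [h2]; linarith
  · have h1 : (1 : ℝ) = ∑ ω, P ω := hP1.symm
    rw [h1, Finset.sum_mul, ← Finset.sum_add_distrib, ← Finset.sum_neg_distrib]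
    refine Finset.sum_le_sum fun ω _ => ?_
    rw [← mul_neg]
    split_ifs with hg
    · have : Real.logb 2 (2⁻¹) ≤ Real.logb 2 (2⁻¹ + (2 * (Fintype.card A : ℝ))⁻¹) :=
        Real.logb_le_logb_of_le one_lt_two (by norm_num) (by linarith)
      rw [Real.logb_inv, Real.logb_self_eq_one one_lt_two] at this
      nlinarith [hP ω]
    · rw [zero_add, Real.logb_inv, Real.logb_mul two_ne_zero hN0.ne',
        Real.logb_self_eq_one one_lt_two]
      linarith

theorem continuous_entropy (f : Ω → A) : Continuous fun P : Ω → ℝ => entropy P f := by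
  classical
  unfold entropy marginal
  refine continuous_finsetSum _ fun v _ => (Real.continuous_negMulLog.comp ?_).div_const _
  refine continuous_finsetSum _ fun ω _ => ?_
  split_ifs
  · exact continuous_apply ω
  · exact continuous_const

theorem continuous_condMutualInfo (f : Ω → A) (g : Ω → B) (h : Ω → C) :
    Continuous fun P : Ω → ℝ => condMutualInfo P f g h := by
  unfold condMutualInfo condEntropy
  exact ((continuous_entropy _).sub (continuous_entropy _)).sub
    ((continuous_entropy _).sub (continuous_entropy _))

end Information

/-! ### Sequential products of kernels on finite sequences -/

section Resampling

variable {n : ℕ} {O : Type*} [Fintype O]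

theorem sum_sum_update (k : Fin n) (g : (Fin n → O) → ℝ) :
    ∑ y, ∑ v, g (Function.update y k v) = Fintype.card O * ∑ y, g y := by
  -- Exchanging coordinate `k` with the spare letter is an involution, so it preserves the sum over
  -- pairs.
  let e : (Fin n → O) × O → (Fin n → O) × O := fun p => (Function.update p.1 k p.2, p.1 k)
  have he : Function.Involutive e := fun p => by simp [e]
  have h := Equiv.sum_comp (he.toPerm e) fun p => g p.1
  simp only [Function.Involutive.coe_toPerm, Fintype.sum_prod_type, e] at h
  simpa [Finset.mul_sum] using h

/-- `F` depends only on the coordinates before `k`. -/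
def DependsOnPast {E : Sort*} (k : ℕ) (F : (Fin n → O) → E) : Prop :=
  ∀ y (j : Fin n) v, k ≤ j → F (Function.update y j v) = F y

omit [Fintype O] in
theorem DependsOnPast.mono {E : Sort*} {k l : ℕ} {F : (Fin n → O) → E} (h : DependsOnPast k F)
    (hkl : k ≤ l) : DependsOnPast l F := fun y j v hj => h y j v (hkl.trans hj)

variable {q : Fin n → (Fin n → O) → O → ℝ}

/-- Resampling coordinate `k` affects only the last kernel and the second argument of `H`. The
factor `card O` pays for the coordinate that becomes free. -/
theorem card_mul_sum_prod_succ (hq : ∀ k : Fin n, DependsOnPast k (q k)) (k : Fin n)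
    (H : (Fin n → O) → O → ℝ) (hH : DependsOnPast k H) :
    Fintype.card O * ∑ y, (∏ j ∈ Finset.univ.filter (fun j : Fin n => (j : ℕ) < k + 1),
        q j y (y j)) * H y (y k) =
      ∑ y, (∏ j ∈ Finset.univ.filter (fun j : Fin n => (j : ℕ) < k), q j y (y j)) *
        ∑ v, q k y v * H y v := by
  rw [← sum_sum_update k]
  refine Finset.sum_congr rfl fun y _ => ?_
  rw [Finset.mul_sum]
  refine Finset.sum_congr rfl fun v _ => ?_
  have hs : (Finset.univ.filter fun j : Fin n => (j : ℕ) < k + 1) =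
      insert k (Finset.univ.filter fun j : Fin n => (j : ℕ) < k) := by
    ext j; simp [Fin.ext_iff]; omega
  rw [hs, Finset.prod_insert (by simp), hH y k v le_rfl, hq k y k v le_rfl,
    Function.update_self, mul_comm (q k y v), mul_assoc]
  congr 1
  refine Finset.prod_congr rfl fun j hj => ?_
  have hj : (j : ℕ) < k := by simpa using hj
  have hjk : j ≠ k := fun h => by simp [h] at hj
  rw [hq j y k v hj.le, Function.update_of_ne hjk]

/-- Kernels at times `k` and later each sum to one and can be peeled off from the end. Sums still
run over full sequences, so every removed kernel leaves a free coordinate and a factor `card O`. -/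
theorem card_pow_mul_sum_prod (hq : ∀ k : Fin n, DependsOnPast k (q k))
    (hq1 : ∀ k y, ∑ v, q k y v = 1) (d k : ℕ) (hd : k + d = n)
    (F : (Fin n → O) → ℝ) (hF : DependsOnPast k F) :
    (Fintype.card O : ℝ) ^ d * ∑ y, (∏ j, q j y (y j)) * F y =
      ∑ y, (∏ j ∈ Finset.univ.filter (fun j : Fin n => (j : ℕ) < k), q j y (y j)) * F y := by
  induction d generalizing k with
  | zero =>
    have : (Finset.univ.filter fun j : Fin n => (j : ℕ) < k) = Finset.univ := by
      ext j; simp; omega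
    simp [this]
  | succ d ih =>
    rw [pow_succ', mul_assoc, ih (k + 1) (by omega) (hF.mono (Nat.le_succ k)),
      card_mul_sum_prod_succ hq ⟨k, by omega⟩ (fun y _ => F y)
        fun y j v hj => funext fun _ => hF y j v hj]
    simp [← Finset.sum_mul, hq1]

theorem sum_prod_eq_one [Nonempty O] (hq : ∀ k : Fin n, DependsOnPast k (q k))
    (hq1 : ∀ k y, ∑ v, q k y v = 1) : ∑ y : Fin n → O, ∏ j, q j y (y j) = 1 := by
  have h := card_pow_mul_sum_prod hq hq1 n 0 (by simp) (fun _ => 1) fun _ _ _ _ => rfl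
  have h0 : (Fintype.card O : ℝ) ≠ 0 := by simp
  simpa [h0] using h

/-- Given the past, the outcome at time `k` has the law `q k`. -/
theorem sum_prod_mul [Nonempty O] (hq : ∀ k : Fin n, DependsOnPast k (q k))
    (hq1 : ∀ k y, ∑ v, q k y v = 1) (k : Fin n)
    (H : (Fin n → O) → O → ℝ) (hH : DependsOnPast k H) :
    ∑ y, (∏ j, q j y (y j)) * H y (y k) =
      ∑ y, (∏ j, q j y (y j)) * ∑ v, q k y v * H y v := by
  obtain ⟨d, hd⟩ : ∃ d, (k : ℕ) + 1 + d = n := ⟨n - (k + 1), by omega⟩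
  have h0 : (Fintype.card O : ℝ) ≠ 0 := by simp
  have hG : DependsOnPast k fun y => ∑ v, q k y v * H y v := fun y j v hj => by
    simp only [hq k y j v hj, hH y j v hj]
  have h1 : DependsOnPast ((k : ℕ) + 1) fun y => H y (y k) := fun y j v hj => by
    have : k ≠ j := fun h => by simp [h] at hj
    simp only [hH y j v (by omega), Function.update_of_ne this]
  refine mul_left_cancel₀ h0 (mul_left_cancel₀ (pow_ne_zero d h0) ?_)
  rw [mul_left_comm, card_pow_mul_sum_prod hq hq1 d _ hd _ h1, card_mul_sum_prod_succ hq k H hH,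
    mul_left_comm, card_pow_mul_sum_prod hq hq1 d _ hd _ (hG.mono (Nat.le_succ _)),
    card_mul_sum_prod_succ hq k (fun y _ => ∑ v, q k y v * H y v)
      fun y j v hj => funext fun _ => hG y j v hj]
  simp [← Finset.sum_mul, hq1]

end Resampling

/-! ### The law induced by a code, and memorylessness -/

section CodeLaw

variable {m t n : ℕ} {X Y : MHMRNode m → Type*} [∀ i, Fintype (Y i)]
  {R : Fin t → Finset (MHMRNode m)} {M : MHMRNode m → ℕ}

omit [∀ i, Fintype (Y i)] in
theorem Code.dependsOnPast_input (c : Code n X Y R M) (w : ∀ i, Fin (M i)) (k : Fin n) :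
    DependsOnPast k fun y => c.input w y k := by
  intro y j v hj
  refine funext fun i => congrArg (c.encode i (w i) k) (funext fun l => ?_)
  rw [Function.update_of_ne]
  intro h
  have := congrArg Fin.val h
  simp at this
  omega

/-- The joint law of the messages and the received sequences. -/
noncomputable def Code.jointDist (W : Channel X Y) (c : Code n X Y R M) :
    (∀ i, Fin (M i)) × (Fin n → Output Y) → ℝ :=
  fun ω => c.law W ω.1 ω.2

theorem Code.law_nonneg (W : Channel X Y) (c : Code n X Y R M) (w : ∀ i, Fin (M i))
    (y : Fin n → Output Y) : 0 ≤ c.law W w y :=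
  mul_nonneg (inv_nonneg.2 (Finset.prod_nonneg fun _ _ => Nat.cast_nonneg _))
    (Finset.prod_nonneg fun _ _ => (W.prob_mem _).1 _)

theorem Code.jointDist_nonneg (W : Channel X Y) (c : Code n X Y R M) (ω) :
    0 ≤ c.jointDist W ω :=
  c.law_nonneg W ω.1 ω.2

theorem Code.sum_law (W : Channel X Y) (c : Code n X Y R M) (w : ∀ i, Fin (M i)) :
    ∑ y, c.law W w y = (∏ i, (M i : ℝ))⁻¹ := by
  simp only [Code.law]
  rw [← Finset.mul_sum, sum_prod_eq_one (q := fun k y v => W.prob (c.input w y k) v)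
    (fun k y j v hj => by simp only [c.dependsOnPast_input w k y j v hj])
    (fun k y => (W.prob_mem _).2), mul_one]

theorem Code.jointDist_mem (W : Channel X Y) (c : Code n X Y R M) (hM : ∀ i, 0 < M i) :
    c.jointDist W ∈ stdSimplex ℝ ((∀ i, Fin (M i)) × (Fin n → Output Y)) := by
  refine ⟨c.jointDist_nonneg W, ?_⟩
  rw [Fintype.sum_prod_type]
  simp only [Code.jointDist, Code.sum_law, Finset.sum_const, Finset.card_univ, Fintype.card_pi,
    Fintype.card_fin, nsmul_eq_mul, Nat.cast_prod]
  exact mul_inv_cancel₀ (Finset.prod_ne_zero_iff.2 fun i _ => by exact_mod_cast (hM i).ne')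

theorem Code.marginal_fst (W : Channel X Y) (c : Code n X Y R M) (w : ∀ i, Fin (M i)) :
    marginal (c.jointDist W) Prod.fst w = (∏ i, (M i : ℝ))⁻¹ := by
  classical
  rw [← c.sum_law W w, marginal, Fintype.sum_prod_type, Finset.sum_eq_single w]
  · simp [Code.jointDist]
  · intro w' _ h; simp [h]
  · simp

/-- The channel is memoryless: given a function `Z` of the messages and of the past that determines
the channel input at time `k`, the output at time `k` has the law given by the channel. -/
theorem Code.marginal_output {A C : Type*} (W : Channel X Y) (c : Code n X Y R M) (k : Fin n)
    (f : Output Y → A) (Z : (∀ i, Fin (M i)) × (Fin n → Output Y) → C)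
    (hZ : ∀ w, DependsOnPast k fun y => Z (w, y)) (a : A) (z : C) (x : Input X)
    (hx : ∀ ω, Z ω = z → c.input ω.1 ω.2 k = x) :
    marginal (c.jointDist W) (fun ω => (f (ω.2 k), Z ω)) (a, z) =
      marginal (c.jointDist W) Z z * marginal (W.prob x) f a := by
  classical
  -- For fixed messages the law is a sequential product, so `sum_prod_mul` applies to the indicator
  -- of the event.
  have h : ∀ w, ∑ y, c.law W w y * (if f (y k) = a ∧ Z (w, y) = z then 1 else 0) =
      ∑ y, c.law W w y * ∑ v, W.prob (c.input w y k) v *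
        (if f v = a ∧ Z (w, y) = z then 1 else 0) := by
    intro w
    simp only [Code.law, mul_assoc]
    rw [← Finset.mul_sum, ← Finset.mul_sum,
      sum_prod_mul (q := fun k y v => W.prob (c.input w y k) v)
      (fun k y j v hj => by simp only [c.dependsOnPast_input w k y j v hj])
      (fun k y => (W.prob_mem _).2) k (fun y v => if f v = a ∧ Z (w, y) = z then 1 else 0)
      (fun y j v hj => by have := hZ w y j v hj; simp only at this; simp only [this])]
  have h2 := Finset.sum_congr rfl fun (w : ∀ i, Fin (M i)) (_ : w ∈ Finset.univ) => h w
  rw [← Fintype.sum_prod_type' (f := fun w y => c.law W w y *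
      (if f (y k) = a ∧ Z (w, y) = z then 1 else 0)),
    ← Fintype.sum_prod_type' (f := fun w y => c.law W w y * ∑ v, W.prob (c.input w y k) v *
        (if f v = a ∧ Z (w, y) = z then 1 else 0))] at h2
  simp only [marginal, Prod.mk.injEq, Finset.sum_mul]
  simp only [mul_ite, mul_one, mul_zero] at h2
  refine (Eq.trans ?_ h2).trans ?_
  · rfl
  · refine Finset.sum_congr rfl fun ω _ => ?_
    by_cases hz : Z ω = z
    · simp [hz, hx ω hz, Code.jointDist]
    · simp [hz]

variable [∀ i, Fintype (X i)]

/-- The law of the joint channel input at time `k`. -/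
noncomputable def Code.inputLaw (W : Channel X Y) (c : Code n X Y R M) (k : Fin n) : Input X → ℝ :=
  marginal (c.jointDist W) fun ω => c.input ω.1 ω.2 k

omit [∀ i, Fintype (X i)] in
-- Memorylessness with the current input itself as the conditioning variable: one channel use of a
-- code is a single-letter experiment.
theorem Code.marginal_input_output (W : Channel X Y) (c : Code n X Y R M) (k : Fin n) :
    marginal (c.jointDist W) (fun ω => (c.input ω.1 ω.2 k, ω.2 k)) =
      jointLaw W (c.inputLaw W k) := by
  classical
  funext ⟨x, v⟩
  have h := c.marginal_output W k id (fun ω => c.input ω.1 ω.2 k)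
    (fun w => c.dependsOnPast_input w k) v x x fun _ h => h
  rw [jointLaw, Code.inputLaw]
  have h1 : marginal (W.prob x) id v = W.prob x v := by
    rw [marginal, Finset.sum_eq_single v] <;> simp +contextual
  rw [h1] at h
  rw [← h]
  exact marginal_congr fun ω _ => by simp [and_comm]

theorem Code.isInputLaw_inputLaw (W : Channel X Y) (c : Code n X Y R M) (hM : ∀ i, 0 < M i)
    (k : Fin n) : IsInputLaw (R (c.phase k).rev) (c.inputLaw W k) := by
  classical
  refine ⟨⟨marginal_nonneg (c.jointDist_nonneg W) _, ?_⟩, fun x hx i => ?_⟩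
  · rw [Code.inputLaw, sum_marginal]
    exact (c.jointDist_mem W hM).2
  · rw [Code.inputLaw, marginal] at hx
    obtain ⟨ω, -, h⟩ := Finset.exists_ne_zero_of_sum_ne_zero hx
    have h1 : c.input ω.1 ω.2 k = x := by
      by_contra h2
      simp [h2] at h
    rw [← h1]
    exact c.encode_isSome _ _ _ _

/-! ### The cut-set bound for a single code -/

/-- The received symbols of the nodes in `D` before time `k`. -/
def past (D : Finset (MHMRNode m)) (k : ℕ) (y : Fin n → Output Y) :
    Fin n → Option (∀ i : D, Option (Y i)) :=
  fun j => if (j : ℕ) < k then some (D.restrict (y j)) else none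

omit [∀ i, Fintype (Y i)] in
theorem past_eq_iff {D : Finset (MHMRNode m)} {k : ℕ} {y y' : Fin n → Output Y} :
    past D k y = past D k y' ↔ ∀ j : Fin n, (j : ℕ) < k → ∀ i ∈ D, y j i = y' j i := by
  simp only [past, funext_iff]
  refine forall_congr' fun j => ?_
  by_cases hj : (j : ℕ) < k
  · simp [hj, funext_iff]
  · simp [hj]

omit [∀ i, Fintype (Y i)] in
theorem dependsOnPast_past (D : Finset (MHMRNode m)) (k : ℕ) :
    DependsOnPast k (past (n := n) (Y := Y) D k) := by
  intro y j v hj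
  rw [past_eq_iff]
  intro l hl i _
  rw [Function.update_of_ne]
  rintro rfl
  omega

/-- The chain rule for the sequence received by the nodes in `D`. -/
theorem sum_condEntropy_past {U C : Type*} [Fintype U] [Fintype C] (D : Finset (MHMRNode m))
    (P : U × (Fin n → Output Y) → ℝ) (V : U × (Fin n → Output Y) → C) :
    ∑ k : Fin n, condEntropy P (fun ω => D.restrict (ω.2 k)) (fun ω => (V ω, past D k ω.2)) =
      entropy P (fun ω => (V ω, past D n ω.2)) - entropy P V := by
  have h0 : entropy P V = entropy P (fun ω => (V ω, past D 0 ω.2)) :=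
    -- The past at time 0 is constant, so the chain-rule sum telescopes down to the entropy of `V`.
    entropy_congr fun ω ω' _ _ => by simp [past_eq_iff]
  rw [h0, ← Finset.sum_range_sub (fun k => entropy P (fun ω => (V ω, past D k ω.2))) n,
    Finset.sum_range]
  refine Finset.sum_congr rfl fun k _ => ?_
  rw [condEntropy]
  congr 1
  refine entropy_congr fun ω ω' _ _ => ?_
  rw [Prod.mk.injEq, Prod.mk.injEq, Prod.mk.injEq, past_eq_iff, past_eq_iff]
  constructor
  · rintro ⟨h1, h2, h3⟩
    refine ⟨h2, fun j hj i hi => ?_⟩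
    rcases Nat.lt_succ_iff_lt_or_eq.1 hj with h | h
    · exact h3 j h i hi
    · rw [Fin.ext h]; exact congrFun h1 ⟨i, hi⟩
  · rintro ⟨h1, h2⟩
    exact ⟨funext fun i => h2 k (Nat.lt_succ_self _) i i.2, h1, fun j hj => h2 j (hj.trans_le
      (Nat.le_succ _))⟩

/-- The mutual information between the inputs of all nodes and the outputs at `D`, given the inputs
at `D`. -/
noncomputable def cutInfo (W : Channel X Y) (p : Input X → ℝ) (D : Finset (MHMRNode m)) : ℝ :=
  condEntropy (jointLaw W p) (fun ω => D.restrict ω.2) (fun ω => D.restrict ω.1) -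
    condEntropy (jointLaw W p) (fun ω => D.restrict ω.2) Prod.fst

/-- The messages of all nodes but `s`. -/
def otherMessages (s : MHMRNode m) (w : ∀ i, Fin (M i)) : ∀ i : {i // i ≠ s}, Fin (M i) :=
  fun i => w i

theorem otherMessages_eq_iff {s : MHMRNode m} {w w' : ∀ i, Fin (M i)} :
    otherMessages s w = otherMessages s w' ↔ ∀ i, i ≠ s → w i = w' i := by
  simp [otherMessages, funext_iff]

theorem message_and_otherMessages_eq_iff {s : MHMRNode m} {w w' : ∀ i, Fin (M i)} :
    w s = w' s ∧ otherMessages s w = otherMessages s w' ↔ w = w' := by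
  rw [otherMessages_eq_iff, funext_iff]
  refine ⟨fun h i => ?_, fun h => ⟨h s, fun i _ => h i⟩⟩
  rcases eq_or_ne i s with rfl | hi
  exacts [h.1, h.2 i hi]

omit [∀ i, Fintype (X i)] in
-- Messages are independent and uniform, so the others reveal nothing about the one at `s`.
theorem Code.condEntropy_message (W : Channel X Y) (c : Code n X Y R M) (s : MHMRNode m)
    (hM : ∀ i, 0 < M i) :
    condEntropy (c.jointDist W) (fun ω => ω.1 s) (fun ω => otherMessages s ω.1) =
      Real.logb 2 (M s) := by
  have hs : (M s : ℝ) ≠ 0 := by exact_mod_cast (hM s).ne'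
  have h1 : ∀ w : ∀ i, Fin (M i), marginal (c.jointDist W)
      (fun ω => (ω.1 s, otherMessages s ω.1)) (w s, otherMessages s w) =
      (∏ i, (M i : ℝ))⁻¹ := fun w => by
    rw [← c.marginal_fst W w]
    exact marginal_congr fun ω _ => by
      rw [Prod.mk.injEq]; exact message_and_otherMessages_eq_iff
  have h2 : ∀ w : ∀ i, Fin (M i), marginal (c.jointDist W)
      (fun ω => otherMessages s ω.1) (otherMessages s w) =
      M s * (∏ i, (M i : ℝ))⁻¹ := fun w => by
    rw [← sum_marginal_pair _ (fun ω => ω.1 s)]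
    have : ∀ a : Fin (M s), marginal (c.jointDist W)
        (fun ω => (ω.1 s, otherMessages s ω.1)) (a, otherMessages s w) =
        (∏ i, (M i : ℝ))⁻¹ := fun a => by
      have h3 : otherMessages s w = otherMessages s (Function.update w s a) :=
        otherMessages_eq_iff.2 fun i hi => by rw [Function.update_of_ne hi]
      have := h1 (Function.update w s a)
      rwa [Function.update_self, ← h3] at this
    simp [this]
  rw [condEntropy_eq_neg_sum (c.jointDist_nonneg W) _ _ (fun _ => (M s : ℝ)⁻¹),
    ← Finset.sum_mul, (c.jointDist_mem W hM).2, Real.logb_inv]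
  · ring
  · intro ω _
    rw [h1, h2]
    field_simp

/-- The cut-set bound for a code: the rate of the messages at `s` that are decoded at `d`. -/
theorem Code.logb_le_cutInfo (W : Channel X Y) (c : Code n X Y R M) (hM : ∀ i, 0 < M i)
    {s d : MHMRNode m} (D : Finset (MHMRNode m)) (hs : s ∉ D) (hd : d ∈ D)
    (g : Fin (M d) → (Fin n → Option (Y d)) → Option (Fin (M s))) :
    Real.logb 2 (M s) ≤
      1 + (∑ w : ∀ i, Fin (M i), ∑ y : Fin n → Output Y,
        if g (w d) (fun k => y k d) = some (w s) then 0 else c.law W w y) * Real.logb 2 (M s) +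
      ∑ k, cutInfo W (c.inputLaw W k) D := by
  classical
  have hP0 := c.jointDist_nonneg W
  have hds : d ≠ s := fun h => hs (h ▸ hd)
  have fano : condEntropy (c.jointDist W) (fun ω => ω.1 s)
      (fun ω => (otherMessages s ω.1, past D n ω.2)) ≤ 1 + (∑ w : ∀ i, Fin (M i),
        ∑ y : Fin n → Output Y,
        if g (w d) (fun k => y k d) = some (w s) then 0 else c.law W w y) *
          Real.logb 2 (M s) := by
    -- The decoder's data are part of the conditioning: its message because `d ≠ s`, its received
    -- sequence because `d ∈ D`.
    have h1 := condEntropy_le_of_determines hP0 (fun ω => ω.1 s)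
      (h := fun ω => (otherMessages s ω.1, past D n ω.2))
      (h' := fun ω => (ω.1 d, fun k => ω.2 k d)) (fun ω ω' _ _ h => by
        simp only [Prod.mk.injEq, otherMessages_eq_iff, past_eq_iff] at h ⊢
        exact ⟨h.1 d hds, funext fun k => h.2 k k.2 d hd⟩)
    refine (h1.trans (condEntropy_le_fano (c.jointDist_mem W hM) (fun ω => ω.1 s)
      (fun ω => (ω.1 d, fun k => ω.2 k d)) fun z => g z.1 z.2)).trans_eq ?_
    rw [Fintype.card_fin, Fintype.sum_prod_type]
    congr! 6
  have h1 : entropy (c.jointDist W) (fun ω => (ω.1 s, otherMessages s ω.1)) =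
      entropy (c.jointDist W) Prod.fst := entropy_congr fun ω ω' _ _ => by
    rw [Prod.mk.injEq]; exact message_and_otherMessages_eq_iff
  have h2 : entropy (c.jointDist W)
      (fun ω => (ω.1 s, otherMessages s ω.1, past D n ω.2)) =
      entropy (c.jointDist W) (fun ω => (ω.1, past D n ω.2)) := entropy_congr fun ω ω' _ _ => by
    rw [Prod.mk.injEq, Prod.mk.injEq, Prod.mk.injEq, ← and_assoc,
      message_and_otherMessages_eq_iff]
  have hmsg := c.condEntropy_message W s hM
  have c1 := sum_condEntropy_past D (c.jointDist W) (fun ω => otherMessages s ω.1)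
  have c2 := sum_condEntropy_past D (c.jointDist W) Prod.fst
  rw [condEntropy, h2] at fano
  rw [condEntropy, h1] at hmsg
  have key : ∑ k : Fin n, condEntropy (c.jointDist W) (fun ω => D.restrict (ω.2 k))
        (fun ω => (otherMessages s ω.1, past D k ω.2)) -
      ∑ k : Fin n, condEntropy (c.jointDist W) (fun ω => D.restrict (ω.2 k))
        (fun ω => (ω.1, past D k ω.2)) ≤ ∑ k, cutInfo W (c.inputLaw W k) D := by
    rw [← Finset.sum_sub_distrib]
    refine Finset.sum_le_sum fun k _ => ?_
    rw [cutInfo, ← c.marginal_input_output, condEntropy_marginal, condEntropy_marginal]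
    -- First term: as `s ∉ D`, the encoders in `D` use only the other messages and the past at `D`,
    -- which thus determine the inputs there.
    refine sub_le_sub (condEntropy_le_of_determines hP0 _ fun ω ω' _ _ h => ?_) ?_
    · simp only [Prod.mk.injEq, otherMessages_eq_iff, past_eq_iff] at h
      funext ⟨i, hi⟩
      have his : i ≠ s := fun h => hs (h ▸ hi)
      simp only [Finset.restrict, Code.input, h.1 i his]
      exact congrArg _ (funext fun j => h.2 _ j.2 i hi)
    -- Second term: enlarge the past to all nodes. Then the conditioning determines the whole
    -- channel input, and both entropies average the same channel likelihood.
    · refine le_trans (le_of_eq ?_) (condEntropy_le_of_determines hP0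
        (fun ω => D.restrict (ω.2 k)) (h := fun ω => (ω.1, past Finset.univ k ω.2))
        (h' := fun ω => (ω.1, past D k ω.2)) fun ω ω' _ _ h => ?_)
      · rw [condEntropy_eq_neg_sum hP0 _ _ (fun ω => marginal (W.prob (c.input ω.1 ω.2 k))
            D.restrict (D.restrict (ω.2 k))) fun ω _ => ?_,
          condEntropy_eq_neg_sum hP0 _ _ (fun ω => marginal (W.prob (c.input ω.1 ω.2 k))
            D.restrict (D.restrict (ω.2 k))) fun ω _ => ?_]
        · refine c.marginal_output W k D.restrict (fun ω => (ω.1, past Finset.univ k ω.2))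
            (fun w y j v hj => ?_) _ _ _ fun ω' h => ?_
          · simp only [dependsOnPast_past _ _ y j v hj]
          · simp only [Prod.mk.injEq, past_eq_iff] at h
            simp only [h.1]
            exact funext fun i => congrArg _ (funext fun j => h.2 _ j.2 i (Finset.mem_univ i))
        · exact c.marginal_output W k D.restrict (fun ω => c.input ω.1 ω.2 k)
            (fun w => c.dependsOnPast_input w k) _ _ _ fun _ h => h
      · simp only [Prod.mk.injEq, past_eq_iff] at h ⊢
        exact ⟨h.1, fun j hj i _ => h.2 j hj i (Finset.mem_univ i)⟩
  linarith

end CodeLaw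

/-! ### Single-letter information: concavity, the half-duplex form, compactness -/

section SingleLetterBounds

variable {m : ℕ} {X Y : MHMRNode m → Type*} [∀ i, Fintype (X i)] [∀ i, Fintype (Y i)]

omit [∀ i, Fintype (X i)] in
theorem jointLaw_nonneg (W : Channel X Y) {p : Input X → ℝ} (hp : ∀ x, 0 ≤ p x)
    (ω : Input X × Output Y) : 0 ≤ jointLaw W p ω :=
  mul_nonneg (hp _) ((W.prob_mem _).1 _)

/-- Linearity in `p` of this term is what reduces concavity of `cutInfo` to that of conditional
entropy. -/
theorem condEntropy_jointLaw_fst {A : Type*} [Fintype A] (W : Channel X Y) {p : Input X → ℝ}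
    (hp : ∀ x, 0 ≤ p x) (f : Output Y → A) :
    condEntropy (jointLaw W p) (fun ω => f ω.2) Prod.fst = ∑ x, p x * entropy (W.prob x) f := by
  classical
  have h1 : ∀ x, marginal (jointLaw W p) Prod.fst x = p x := by
    intro x
    rw [marginal, Fintype.sum_prod_type, Finset.sum_eq_single x]
    · simp [jointLaw, ← Finset.mul_sum, (W.prob_mem x).2]
    · intro x' _ h; simp [h]
    · simp
  have h2 : ∀ a x, marginal (jointLaw W p) (fun ω => (f ω.2, ω.1)) (a, x) =
      p x * marginal (W.prob x) f a := by
    intro a x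
    rw [marginal, Fintype.sum_prod_type, Finset.sum_eq_single x]
    · simp [jointLaw, marginal, Finset.mul_sum]
    · intro x' _ h; simp [h]
    · simp
  rw [condEntropy_eq_neg_sum (jointLaw_nonneg W hp) _ _
    (fun ω => marginal (W.prob ω.1) f (f ω.2)) fun ω _ => by rw [h1]; exact h2 _ _,
    Fintype.sum_prod_type, ← Finset.sum_neg_distrib]
  refine Finset.sum_congr rfl fun x _ => ?_
  rw [entropy_eq_neg_sum, mul_neg, Finset.mul_sum]
  simp only [jointLaw, mul_assoc]

/-- `cutInfo` is concave in the input distribution. -/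
theorem sum_cutInfo_le {ι : Type*} (W : Channel X Y) (s : Finset ι) (c : ι → ℝ)
    (hc : ∀ k ∈ s, 0 < c k) (p : ι → Input X → ℝ) (hp : ∀ k x, 0 ≤ p k x)
    (D : Finset (MHMRNode m)) :
    ∑ k ∈ s, c k * cutInfo W (p k) D ≤ cutInfo W (fun x => ∑ k ∈ s, c k * p k x) D := by
  have hq : ∀ x, 0 ≤ ∑ k ∈ s, c k * p k x := fun x =>
    Finset.sum_nonneg fun k hk => mul_nonneg (hc k hk).le (hp k x)
  have hj : jointLaw W (fun x => ∑ k ∈ s, c k * p k x) =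
      fun ω => ∑ k ∈ s, c k * jointLaw W (p k) ω := by
    funext ω
    simp only [jointLaw, Finset.sum_mul, mul_assoc]
  have h1 := sum_condEntropy_le s c hc (fun k => jointLaw W (p k))
    (fun k => jointLaw_nonneg W (hp k)) (fun ω => D.restrict ω.2) (fun ω => D.restrict ω.1)
  rw [← hj] at h1
  have h2 : ∑ k ∈ s, c k * condEntropy (jointLaw W (p k)) (fun ω => D.restrict ω.2) Prod.fst =
      condEntropy (jointLaw W fun x => ∑ k ∈ s, c k * p k x)
        (fun ω => D.restrict ω.2) Prod.fst := by
    rw [condEntropy_jointLaw_fst W hq]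
    simp only [condEntropy_jointLaw_fst W (hp _), Finset.mul_sum, Finset.sum_mul, mul_assoc]
    rw [Finset.sum_comm]
  simp only [cutInfo, mul_sub, Finset.sum_sub_distrib]
  linarith

theorem restrict_eq_iff {ι : Type*} {E : ι → Type*} {T : Finset ι} {x x' : ∀ i, E i} :
    T.restrict x = T.restrict x' ↔ ∀ i ∈ T, x i = x' i := by
  simp [funext_iff]

/-- Silent nodes have constant input and, by half-duplex, transmitters have constant output; such
coordinates carry no entropy. -/
theorem IsInputLaw.support {W : Channel X Y} {T : Finset (MHMRNode m)} {p : Input X → ℝ}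
    (hp : IsInputLaw T p) {ω : Input X × Output Y} (h : jointLaw W p ω ≠ 0) :
    (∀ i ∉ T, ω.1 i = none) ∧ ∀ i ∈ T, ω.2 i = none := by
  have h1 := hp.2 ω.1 (left_ne_zero_of_mul h)
  refine ⟨fun i hi => ?_, fun i hi => ?_⟩
  · rw [← h1] at hi
    simpa using hi
  · by_contra h2
    refine right_ne_zero_of_mul h (W.half_duplex _ _ i ?_ h2)
    exact Option.isSome_iff_ne_none.1 ((h1 i).2 hi)

/-- On the support, the two sides involve functions inducing the same partitions, so their entropies
agree one by one. -/
theorem cutInfo_eq_info_of_split (W : Channel X Y) {T A B C D : Finset (MHMRNode m)}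
    {p : Input X → ℝ} (hp : IsInputLaw T p) (hC : ∀ i, i ∈ C ↔ i ∈ D ∧ i ∈ T)
    (hB : ∀ i ∈ B, i ∈ D) (hB' : ∀ i ∈ D, i ∉ T → i ∈ B) (hA : ∀ i ∈ T, i ∈ A ∨ i ∈ C) :
    cutInfo W p D = info W p A B C := by
  have hXC : ∀ ω ω', jointLaw W p ω ≠ 0 → jointLaw W p ω' ≠ 0 →
      ((∀ i ∈ D, ω.1 i = ω'.1 i) ↔ ∀ i ∈ C, ω.1 i = ω'.1 i) := fun ω ω' h h' => by
    refine ⟨fun e i hi => e i ((hC i).1 hi).1, fun e i hi => ?_⟩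
    by_cases hT : i ∈ T
    · exact e i ((hC i).2 ⟨hi, hT⟩)
    · rw [(hp.support h).1 i hT, (hp.support h').1 i hT]
  have hXA : ∀ ω ω', jointLaw W p ω ≠ 0 → jointLaw W p ω' ≠ 0 →
      (ω.1 = ω'.1 ↔ (∀ i ∈ A, ω.1 i = ω'.1 i) ∧ ∀ i ∈ C, ω.1 i = ω'.1 i) := fun ω ω' h h' => by
    refine ⟨fun e => by simp [e], fun e => funext fun i => ?_⟩
    by_cases hT : i ∈ T
    · exact (hA i hT).elim (e.1 i) (e.2 i)
    · rw [(hp.support h).1 i hT, (hp.support h').1 i hT]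
  have hYB : ∀ ω ω', jointLaw W p ω ≠ 0 → jointLaw W p ω' ≠ 0 →
      ((∀ i ∈ D, ω.2 i = ω'.2 i) ↔ ∀ i ∈ B, ω.2 i = ω'.2 i) := fun ω ω' h h' => by
    refine ⟨fun e i hi => e i (hB i hi), fun e i hi => ?_⟩
    by_cases hT : i ∈ T
    · rw [(hp.support h).2 i hT, (hp.support h').2 i hT]
    · exact e i (hB' i hi hT)
  have e1 : entropy (jointLaw W p) (fun ω => (D.restrict ω.2, D.restrict ω.1)) =
      entropy (jointLaw W p) (fun ω => (B.restrict ω.2, C.restrict ω.1)) :=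
    entropy_congr fun ω ω' h h' => by
      simp only [Prod.mk.injEq, restrict_eq_iff, hXC ω ω' h h', hYB ω ω' h h']
  have e2 : entropy (jointLaw W p) (fun ω => D.restrict ω.1) =
      entropy (jointLaw W p) (fun ω => C.restrict ω.1) :=
    entropy_congr fun ω ω' h h' => by simp only [restrict_eq_iff, hXC ω ω' h h']
  have e3 : entropy (jointLaw W p) (fun ω => (D.restrict ω.2, ω.1)) =
      entropy (jointLaw W p) (fun ω => (A.restrict ω.1, B.restrict ω.2, C.restrict ω.1)) :=
    entropy_congr fun ω ω' h h' => by
      simp only [Prod.mk.injEq, restrict_eq_iff, hXA ω ω' h h', hYB ω ω' h h']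
      tauto
  have e4 : entropy (jointLaw W p) Prod.fst =
      entropy (jointLaw W p) (fun ω => (A.restrict ω.1, C.restrict ω.1)) :=
    entropy_congr fun ω ω' h h' => by
      simp only [Prod.mk.injEq, restrict_eq_iff, hXA ω ω' h h']
  simp only [cutInfo, info, condMutualInfo, condEntropy, e1, e2, e3, e4]
  ring

theorem info_empty (W : Channel X Y) (p : Input X → ℝ) (B C : Finset (MHMRNode m)) :
    info W p ∅ B C = 0 := by
  refine sub_eq_zero.2 ((sub_eq_zero.2 ?_).trans (sub_eq_zero.2 ?_).symm) <;>
  exact entropy_congr fun ω ω' _ _ => by simp [restrict_eq_iff]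

theorem cutInfo_eq_zero (W : Channel X Y) {T D : Finset (MHMRNode m)} {p : Input X → ℝ}
    (hp : IsInputLaw T p) (hT : T ⊆ D) : cutInfo W p D = 0 := by
  refine sub_eq_zero.2 (condEntropy_congr (fun ω ω' h h' => ?_) fun _ _ _ _ _ => Iff.rfl)
  rw [restrict_eq_iff]
  refine ⟨fun e => funext fun i => ?_, fun e => by simp [e]⟩
  by_cases hi : i ∈ T
  · exact e i (hT hi)
  · rw [(hp.support h).1 i hi, (hp.support h').1 i hi]

theorem cutInfo_eq_info (W : Channel X Y) {T S : Finset (MHMRNode m)} {s d : MHMRNode m}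
    {p : Input X → ℝ} (hp : IsInputLaw T p) (hT : T = {s} ∨ T = {d} ∨ T ⊆ relays m)
    (hsd : s ≠ d) (hd : d ∉ relays m) (hS : S ⊆ relays m) :
    cutInfo W p ((relays m \ S) ∪ {d}) =
      info W p (T ∩ (S ∪ {s})) (((relays m \ S) \ T) ∪ {d}) ((relays m \ S) ∩ T) := by
  -- If `d` transmits, it is the only transmitter and both sides vanish; otherwise the sets satisfy
  -- the splitting conditions by Boolean algebra.
  by_cases hdT : d ∈ T
  · have hTd : T = {d} := by
      rcases hT with rfl | rfl | h
      · exact absurd (Finset.mem_singleton.1 hdT) hsd.symm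
      · rfl
      · exact absurd (h hdT) hd
    subst hTd
    have hA : ({d} : Finset (MHMRNode m)) ∩ (S ∪ {s}) = ∅ := by
      rw [Finset.singleton_inter_of_notMem]
      simp only [Finset.mem_union, Finset.mem_singleton, not_or]
      exact ⟨fun h => hd (hS h), hsd.symm⟩
    rw [hA, info_empty, cutInfo_eq_zero W hp Finset.subset_union_right]
  · have hT' : ∀ i ∈ T, i = s ∨ i ∈ relays m := by
      intro i hi
      rcases hT with rfl | rfl | h
      · exact Or.inl (Finset.mem_singleton.1 hi)
      · exact absurd (Finset.mem_singleton_self _) hdT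
      · exact Or.inr (h hi)
    have hne : ∀ i ∈ T, i ≠ d := fun i hi h => hdT (h ▸ hi)
    refine cutInfo_eq_info_of_split W hp (fun i => ?_) (fun i => ?_) (fun i => ?_) fun i => ?_ <;>
    · have h1 := hT' i
      have h2 := hne i
      simp only [Finset.mem_union, Finset.mem_inter, Finset.mem_sdiff, Finset.mem_singleton]
      tauto

theorem isCompact_isInputLaw (T : Finset (MHMRNode m)) :
    IsCompact {p : Input X → ℝ | IsInputLaw T p} := by
  refine (isCompact_stdSimplex ℝ (Input X)).inter_right (t := {p : Input X → ℝ |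
    ∀ x, p x ≠ 0 → ∀ i, (x i).isSome = true ↔ i ∈ T}) ?_
  -- The support condition is closed: it says that `p` vanishes at each forbidden input.
  have h : {p : Input X → ℝ | ∀ x, p x ≠ 0 → ∀ i, (x i).isSome = true ↔ i ∈ T} =
      ⋂ x : {x : Input X // ¬∀ i, (x i).isSome = true ↔ i ∈ T}, {p | p x = 0} := by
    ext p
    simp only [Set.mem_ofPred_eq, Set.mem_iInter, Subtype.forall]
    exact forall_congr' fun x => ⟨fun h1 h2 => by_contra fun h3 => h2 (h1 h3),
      fun h1 h2 => by_contra fun h3 => h2 (h1 h3)⟩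
  rw [h]
  exact isClosed_iInter fun x => isClosed_eq (continuous_apply _) continuous_const

theorem exists_isInputLaw [∀ i, Nonempty (X i)] (T : Finset (MHMRNode m)) :
    ∃ p : Input X → ℝ, IsInputLaw T p := by
  classical
  refine ⟨Pi.single (fun i => if i ∈ T then some (Classical.arbitrary _) else none) 1,
    single_mem_stdSimplex _ _, fun x hx i => ?_⟩
  have : x = fun i => if i ∈ T then some (Classical.arbitrary _) else none := by
    by_contra h
    exact hx (Pi.single_eq_of_ne h _)
  rw [this]
  by_cases hi : i ∈ T <;> simp [hi]

theorem IsInputLaw.average {ι : Type*} {T : Finset (MHMRNode m)} {s : Finset ι}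
    (hs : s.Nonempty) {p : ι → Input X → ℝ} (hp : ∀ k ∈ s, IsInputLaw T (p k)) :
    IsInputLaw T fun x => ∑ k ∈ s, (s.card : ℝ)⁻¹ * p k x := by
  have hc : (s.card : ℝ) ≠ 0 := by exact_mod_cast hs.card_pos.ne'
  refine ⟨⟨fun x => Finset.sum_nonneg fun k hk => mul_nonneg (by positivity) ((hp k hk).1.1 x),
    ?_⟩, fun x hx => ?_⟩
  · rw [Finset.sum_comm]
    simp only [← Finset.mul_sum]
    rw [Finset.sum_congr rfl fun k hk => (hp k hk).1.2]
    simp [hc]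
  · obtain ⟨k, hk, h⟩ := Finset.exists_ne_zero_of_sum_ne_zero hx
    exact (hp k hk).2 x (right_ne_zero_of_mul h)

theorem continuous_info (W : Channel X Y) (A B C : Finset (MHMRNode m)) :
    Continuous fun p : Input X → ℝ => info W p A B C := by
  refine (continuous_condMutualInfo _ _ _).comp (continuous_pi fun ω => ?_)
  exact (continuous_apply ω.1).mul continuous_const

end SingleLetterBounds

/-! ### Averaging over phases and passage to the limit -/

section Converse

variable {m t n : ℕ} {X Y : MHMRNode m → Type*} [∀ i, Fintype (X i)] [∀ i, Fintype (Y i)]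
  {R : Fin t → Finset (MHMRNode m)} {M : MHMRNode m → ℕ}

/-- Averaging the input laws over the channel uses of each phase. -/
theorem Code.exists_phase_laws [∀ i, Nonempty (X i)] (W : Channel X Y) (c : Code n X Y R M)
    (hM : ∀ i, 0 < M i) (hn : 0 < n) :
    ∃ p : Fin t → Input X → ℝ, (∀ ℓ, IsInputLaw (R ℓ.rev) (p ℓ)) ∧
      ∀ D, ∑ k, cutInfo W (c.inputLaw W k) D ≤
        n * ∑ ℓ, c.duration ℓ * cutInfo W (p ℓ) D := by
  classical
  have h : ∀ ℓ : Fin t, ∃ p : Input X → ℝ, IsInputLaw (R ℓ.rev) p ∧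
      ∀ D, ∑ k with c.phase k = ℓ, cutInfo W (c.inputLaw W k) D ≤
        n * (c.duration ℓ * cutInfo W p D) := by
    intro ℓ
    rcases (Finset.univ.filter fun k => c.phase k = ℓ).eq_empty_or_nonempty with h0 | h0
    -- An unused phase has duration 0, so any admissible law will do.
    · obtain ⟨p, hp⟩ := exists_isInputLaw (X := X) (R ℓ.rev)
      exact ⟨p, hp, fun D => by simp [h0, Code.duration]⟩
    · have hc : (0 : ℝ) < (Finset.univ.filter fun k => c.phase k = ℓ).card := by
        exact_mod_cast h0.card_pos
      refine ⟨_, IsInputLaw.average h0 (p := c.inputLaw W) fun k hk => ?_, fun D => ?_⟩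
      · have := c.isInputLaw_inputLaw W hM k
        rwa [(Finset.mem_filter.1 hk).2] at this
      · have h1 := sum_cutInfo_le W (Finset.univ.filter fun k => c.phase k = ℓ)
          (fun _ => ((Finset.univ.filter fun k => c.phase k = ℓ).card : ℝ)⁻¹)
          (fun _ _ => inv_pos.2 hc) (c.inputLaw W)
          (fun k => (c.isInputLaw_inputLaw W hM k).1.1) D
        rw [← Finset.mul_sum, inv_mul_le_iff₀ hc] at h1
        refine h1.trans_eq ?_
        have hn' : (n : ℝ) ≠ 0 := by exact_mod_cast hn.ne'
        rw [Code.duration]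
        field_simp
  choose p hp hD using h
  refine ⟨p, hp, fun D => ?_⟩
  rw [Finset.mul_sum, ← Finset.sum_fiberwise (s := Finset.univ) (g := c.phase)]
  exact Finset.sum_le_sum fun ℓ _ => hD ℓ D

theorem le_logb_floor {x : ℝ} (hx : 0 ≤ x) : x - 1 ≤ Real.logb 2 ⌊(2 : ℝ) ^ x⌋₊ := by
  have h1 : (1 : ℝ) ≤ 2 ^ x := Real.one_le_rpow one_le_two hx
  have h2 : (1 : ℝ) ≤ ⌊(2 : ℝ) ^ x⌋₊ := by exact_mod_cast Nat.le_floor (by simpa using h1)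
  rw [Real.le_logb_iff_rpow_le one_lt_two (by linarith), Real.rpow_sub_one two_ne_zero]
  have := Nat.lt_floor_add_one ((2 : ℝ) ^ x)
  linarith

theorem logb_floor_le {x : ℝ} (hx : 0 ≤ x) : Real.logb 2 ⌊(2 : ℝ) ^ x⌋₊ ≤ x := by
  have h1 : (1 : ℝ) ≤ 2 ^ x := Real.one_le_rpow one_le_two hx
  have h2 : (1 : ℝ) ≤ ⌊(2 : ℝ) ^ x⌋₊ := by exact_mod_cast Nat.le_floor (by simpa using h1)
  rw [Real.logb_le_iff_le_rpow one_lt_two (by linarith)]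
  exact Nat.floor_le (by positivity)

theorem msgCount_pos (n : ℕ) {Ra Rb : ℝ} (ha : 0 ≤ Ra) (hb : 0 ≤ Rb) (i : MHMRNode m) :
    0 < msgCount n Ra Rb i := by
  have h : ∀ x : ℝ, 0 ≤ x → 0 < ⌊(2 : ℝ) ^ (n * x)⌋₊ := fun x hx =>
    Nat.floor_pos.2 (Real.one_le_rpow one_le_two (by positivity))
  cases i
  exacts [h _ ha, h _ hb, one_pos]

/-- `r` satisfies all cut-set bounds for the input laws `p` and the phase durations `Δ`. -/
def CutSetBounds (W : Channel X Y) (R : Fin t → Finset (MHMRNode m)) (Δ : Fin t → ℝ)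
    (p : Fin t → Input X → ℝ) (r : ℝ × ℝ) : Prop :=
  ∀ S ⊆ relays m,
    r.1 ≤ ∑ i : Fin t, Δ i.rev * info W (p i.rev) (R i ∩ (S ∪ {MHMRNode.a}))
      (((relays m \ S) \ R i) ∪ {MHMRNode.b}) ((relays m \ S) ∩ R i) ∧
    r.2 ≤ ∑ i : Fin t, Δ i.rev * info W (p i.rev) (R i ∩ (S ∪ {MHMRNode.b}))
      (((relays m \ S) \ R i) ∪ {MHMRNode.a}) ((relays m \ S) ∩ R i)

/-- One subsequence of the laws converges in all phases, and for each cut both sides of the bounds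
converge along it. It serves both the limit in the block length and the closure of the achievable
set. -/
theorem CutSetBounds.exists_of_tendsto (W : Channel X Y) {Δ : Fin t → ℝ} {r : ℝ × ℝ}
    {δ : ℕ → Fin t → ℝ} {p : ℕ → Fin t → Input X → ℝ} {ρ : ℕ → ℝ × ℝ}
    (hp : ∀ n ℓ, IsInputLaw (R ℓ.rev) (p n ℓ)) (h : ∀ n, CutSetBounds W R (δ n) (p n) (ρ n))
    (hδ : Filter.Tendsto δ Filter.atTop (nhds Δ)) (hρ : Filter.Tendsto ρ Filter.atTop (nhds r)) :
    ∃ q : Fin t → Input X → ℝ, (∀ ℓ, IsInputLaw (R ℓ.rev) (q ℓ)) ∧ CutSetBounds W R Δ q r := by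
  obtain ⟨q, hq, φ, hφ, hlim⟩ := (isCompact_univ_pi fun ℓ : Fin t =>
    isCompact_isInputLaw (X := X) (R ℓ.rev)).tendsto_subseq (x := p) fun n ℓ _ => hp n ℓ
  have hδ' := hδ.comp hφ.tendsto_atTop
  have hρ' := hρ.comp hφ.tendsto_atTop
  have hsum : ∀ A B C : Fin t → Finset (MHMRNode m), Filter.Tendsto
      (fun n => ∑ i : Fin t, δ (φ n) i.rev * info W (p (φ n) i.rev) (A i) (B i) (C i))
      Filter.atTop (nhds (∑ i : Fin t, Δ i.rev * info W (q i.rev) (A i) (B i) (C i))) :=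
    fun A B C => tendsto_finsetSum _ fun i _ => (tendsto_pi_nhds.1 hδ' i.rev).mul
      (((continuous_info W (A i) (B i) (C i)).tendsto _).comp (tendsto_pi_nhds.1 hlim i.rev))
  refine ⟨q, fun ℓ => hq ℓ (Set.mem_univ _), fun S hS => ⟨?_, ?_⟩⟩
  · exact le_of_tendsto_of_tendsto' ((continuous_fst.tendsto _).comp hρ') (hsum _ _ _)
      fun n => (h (φ n) S hS).1
  · exact le_of_tendsto_of_tendsto' ((continuous_snd.tendsto _).comp hρ') (hsum _ _ _)
      fun n => (h (φ n) S hS).2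

theorem IsRelayFamily.cases (hR : IsRelayFamily R) (i : Fin t) :
    R i = {MHMRNode.a} ∨ R i = {MHMRNode.b} ∨ R i ⊆ relays m := by
  obtain ⟨h1, h2, h3⟩ := hR i
  by_cases hi : (i : ℕ) = 0
  · exact Or.inl (h1 hi)
  by_cases hi' : (i : ℕ) = t - 1
  · exact Or.inr (Or.inl (h2 hi'))
  · exact Or.inr (Or.inr (h3 (by omega) (by have := i.2; omega)))

theorem a_notMem_relays : MHMRNode.a ∉ relays m := by simp [relays]

theorem b_notMem_relays : MHMRNode.b ∉ relays m := by simp [relays]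

/-- The cut-set bounds at a finite block length. -/
theorem Code.exists_cutSetBounds [∀ i, Nonempty (X i)] (W : Channel X Y) (hR : IsRelayFamily R)
    {Ra Rb : ℝ} (ha : 0 ≤ Ra) (hb : 0 ≤ Rb) (hn : 0 < n) (c : Code n X Y R (msgCount n Ra Rb)) :
    ∃ p : Fin t → Input X → ℝ, (∀ ℓ, IsInputLaw (R ℓ.rev) (p ℓ)) ∧
      CutSetBounds W R c.duration p
        (Ra - c.errorAtB W * Ra - 2 / n, Rb - c.errorAtA W * Rb - 2 / n) := by
  have hM : ∀ i, 0 < msgCount (m := m) n Ra Rb i := msgCount_pos n ha hb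
  have hn' : (0 : ℝ) < n := by exact_mod_cast hn
  obtain ⟨p, hp, hD⟩ := c.exists_phase_laws W hM hn
  refine ⟨p, hp, fun S hS => ?_⟩
  -- The loss 2 / n is one bit from Fano and one from rounding down the message count.
  have rate : ∀ {r e l σ : ℝ}, 0 ≤ e → n * r - 1 ≤ l → l ≤ n * r → l ≤ 1 + e * l + n * σ →
      r - e * r - 2 / n ≤ σ := by
    intro r e l σ he h1 h2 h3
    have h4 := mul_le_mul_of_nonneg_left h2 he
    have h5 : n * (r - e * r - 2 / n) ≤ n * σ := by
      have : n * (r - e * r - 2 / n) = n * r - e * (n * r) - 2 := by field_simp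
      linarith
    exact le_of_mul_le_mul_left h5 hn'
  have single : ∀ {s d : MHMRNode m}, (∀ i, R i = {s} ∨ R i = {d} ∨ R i ⊆ relays m) → s ≠ d →
      d ∉ relays m →
      ∑ ℓ, c.duration ℓ * cutInfo W (p ℓ) ((relays m \ S) ∪ {d}) =
      ∑ i : Fin t, c.duration i.rev * info W (p i.rev) (R i ∩ (S ∪ {s}))
        (((relays m \ S) \ R i) ∪ {d}) ((relays m \ S) ∩ R i) := by
    intro s d hT hsd hd
    rw [← Equiv.sum_comp Fin.revPerm]
    refine Finset.sum_congr rfl fun i _ => ?_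
    have := hp i.rev
    rw [Fin.rev_rev] at this
    rw [Fin.revPerm_apply, cutInfo_eq_info W this (hT i) hsd hd hS]
  have herr : ∀ (q : (∀ i, Fin (msgCount n Ra Rb i)) → (Fin n → Output Y) → Prop)
      [∀ w y, Decidable (q w y)], 0 ≤ ∑ w, ∑ y, if q w y then 0 else c.law W w y := by
    intro q _
    refine Finset.sum_nonneg fun w _ => Finset.sum_nonneg fun y _ => ?_
    split_ifs
    exacts [le_rfl, c.law_nonneg W w y]
  constructor
  · rw [← single hR.cases (by simp) b_notMem_relays]
    have h := c.logb_le_cutInfo W hM (s := .a) (d := .b) ((relays m \ S) ∪ {.b})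
      (by simp [a_notMem_relays]) (by simp) c.decodeAtB
    refine rate (herr _) (le_logb_floor (by positivity)) (logb_floor_le (by positivity))
      (h.trans (add_le_add_right (hD _) _))
  · rw [← single (fun i => by have := hR.cases i; tauto) (by simp) a_notMem_relays]
    have h := c.logb_le_cutInfo W hM (s := .b) (d := .a) ((relays m \ S) ∪ {.a})
      (by simp [b_notMem_relays]) (by simp) c.decodeAtA
    refine rate (herr _) (le_logb_floor (by positivity)) (logb_floor_le (by positivity))
      (h.trans (add_le_add_right (hD _) _))

theorem Achievable.exists_cutSetBounds [∀ i, Nonempty (X i)] (W : Channel X Y)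
    (hR : IsRelayFamily R) {Δ : Fin t → ℝ} {r : ℝ × ℝ} (h : Achievable W R Δ r) :
    ∃ p : Fin t → Input X → ℝ, (∀ ℓ, IsInputLaw (R ℓ.rev) (p ℓ)) ∧ CutSetBounds W R Δ p r := by
  obtain ⟨ha, hb, c, hB, hA, hΔ⟩ := h
  -- Shift to block length n + 1, since the finite bound needs positive length.
  have hs := Filter.tendsto_add_atTop_nat 1
  have h2 : Filter.Tendsto (fun n : ℕ => 2 / ((n + 1 : ℕ) : ℝ)) Filter.atTop (nhds 0) :=
    (tendsto_const_div_atTop_nhds_zero_nat 2).comp hs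
  have key : ∀ {e : ℕ → ℝ} (ρ : ℝ), Filter.Tendsto e Filter.atTop (nhds 0) → Filter.Tendsto
      (fun n => ρ - e (n + 1) * ρ - 2 / ((n + 1 : ℕ) : ℝ)) Filter.atTop (nhds ρ) := by
    intro e ρ he
    simpa using (((he.comp hs).mul_const ρ).const_sub ρ).sub h2
  have hfin : ∀ n : ℕ, ∃ p : Fin t → Input X → ℝ, (∀ ℓ, IsInputLaw (R ℓ.rev) (p ℓ)) ∧
      CutSetBounds W R (c (n + 1)).duration p
        (r.1 - (c (n + 1)).errorAtB W * r.1 - 2 / ((n + 1 : ℕ) : ℝ),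
          r.2 - (c (n + 1)).errorAtA W * r.2 - 2 / ((n + 1 : ℕ) : ℝ)) := fun n =>
    (c (n + 1)).exists_cutSetBounds W hR ha hb n.succ_pos
  choose p hp hc using hfin
  have hδ : Filter.Tendsto (fun n => (c (n + 1)).duration) Filter.atTop (nhds Δ) :=
    tendsto_pi_nhds.2 fun ℓ => (hΔ ℓ).comp hs
  have h1 := (key r.1 hB).prodMk_nhds (key r.2 hA)
  exact CutSetBounds.exists_of_tendsto W hp hc hδ h1

end Converse
end MHMR

theorem mainTheorem8 {m t : ℕ} (ht : 3 < t) (htm : t < m + 2)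
    (X Y : MHMRNode m → Type*) [∀ i, Fintype (X i)] [∀ i, Nonempty (X i)] [∀ i, Fintype (Y i)]
    (W : MHMR.Channel X Y)
    (R : Fin t → Finset (MHMRNode m)) (hR : MHMR.IsRelayFamily R)
    (Δ : Fin t → ℝ) (hΔ : Δ ∈ stdSimplex ℝ (Fin t)) :
    MHMR.capacityRegion W R Δ ⊆
      {r : ℝ × ℝ | ∃ p : Fin t → MHMR.Input X → ℝ,
        (∀ ℓ, MHMR.IsInputLaw (R ℓ.rev) (p ℓ)) ∧
        ∀ S ⊆ MHMR.relays m,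
          r.1 ≤ ∑ i : Fin t, Δ i.rev *
            MHMR.info W (p i.rev)
              (R i ∩ (S ∪ {MHMRNode.a}))
              (((MHMR.relays m \ S) \ R i) ∪ {MHMRNode.b})
              ((MHMR.relays m \ S) ∩ R i) ∧
          r.2 ≤ ∑ i : Fin t, Δ i.rev *
            MHMR.info W (p i.rev)
              (R i ∩ (S ∪ {MHMRNode.b}))
              (((MHMR.relays m \ S) \ R i) ∪ {MHMRNode.a})
              ((MHMR.relays m \ S) ∩ R i)} := by
  intro r hr
  -- Compactness is used a second time, now along achievable pairs and with constant durations.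
  obtain ⟨ρ, hρ, hlim⟩ := mem_closure_iff_seq_limit.1 hr
  choose p hp hc using fun n => MHMR.Achievable.exists_cutSetBounds W hR (hρ n)
  exact MHMR.CutSetBounds.exists_of_tendsto W hp hc tendsto_const_nhds hlim
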